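/- Let $k\ge 2$ and $m\ge 1$ be integers and let $b$ be an integer with $\gcd(b,m)=1$. An integer $q\geq 1$ is called $k$-free if $p^k\nmid q$ for every prime $p\mid q$. For $Q\ge 1$ put \[\mathscr F_{Q,k}^{(m)}=\left\{\frac aq : 1\le a\le q\le Q,\ \gcd(a,q)=1,\ q \text{ is } k\text{-free},\ q\equiv b \pmod m\right\}.\] Then the sequence $\bigl(\mathscr F_{Q,k}^{(m)}\bigr)_{Q\ge1}$ is uniformly distributed modulo one. That is, writing $\{x\}$ for the fractional part of $x$ and $|I|$ for the length of an interval $I$, for every interval $I\subseteq[0,1)$, \[\lim_{Q\to\infty}\frac{\#\{\gamma\in\mathscr F_{Q,k}^{(m)} : \{\gamma\}\in I\}}{\#\mathscr F_{Q,k}^{(m)}}=|I| .\] Moreover, if $(x_n)_{n\ge1}$ is any sequence of real numbers that lists these fractions successively (for every $Q\ge 1$, its first $\#\mathscr F_{Q,k}^{(m)}$ terms are the elements of $\mathscr F_{Q,k}^{(m)}$, each occurring once), then $(x_n)_{n\ge1}$ is uniformly distributed modulo one: for every interval $I\subseteq[0,1)$, \[\lim_{N\to\infty}\frac1N\#\{1\le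 n\le N : \{x_n\}\in I\}=|I| .\] -/

import Mathlib

/-- `n` is `k`-free: for every prime `p ∣ n`, `p ^ k` does not divide `n`. -/
def IsKFree (k n : ℕ) : Prop :=
  ∀ p : ℕ, p.Prime → p ∣ n → ¬ p ^ k ∣ n

/-- The Farey fractions `a / q` of order `Q` whose denominators are `k`-free and congruent to `b`
modulo `m`. -/
def kFreeFarey (k m : ℕ) (b : ℤ) (Q : ℕ) : Set ℝ :=
  {x : ℝ | ∃ a q : ℕ, 1 ≤ a ∧ a ≤ q ∧ q ≤ Q ∧ Nat.gcd a q = 1 ∧ IsKFree k q ∧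
    (q : ℤ) ≡ b [ZMOD (m : ℤ)] ∧ x = (a : ℝ) / (q : ℝ)}

/-- The sequence `x 1, x 2, …` of real numbers is uniformly distributed modulo one (the value `x 0`
plays no role): for every interval `I ⊆ [0, 1)`, of any type, the proportion of `1 ≤ n ≤ N` with
fractional part of `x n` in `I` tends to the length of `I`. -/
def UniformlyDistributedModOne (x : ℕ → ℝ) : Prop :=
  ∀ I : Set ℝ, I.OrdConnected → I ⊆ Set.Ico 0 1 →
    Filter.Tendsto
      (fun N : ℕ => (({n : ℕ | 1 ≤ n ∧ n ≤ N ∧ Int.fract (x n) ∈ I}.ncard : ℕ) : ℝ) / (N : ℝ))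
      Filter.atTop (nhds (MeasureTheory.volume.real I))

/-- A sequence `F 1, F 2, …` of finite sets of real numbers is uniformly distributed modulo one:
for every interval `I ⊆ [0, 1)`, of any type, the proportion of elements of `F Q` with fractional
part in `I` tends to the length of `I` as `Q → ∞`. -/
def SetsUniformlyDistributedModOne (F : ℕ → Set ℝ) : Prop :=
  ∀ I : Set ℝ, I.OrdConnected → I ⊆ Set.Ico 0 1 →
    Filter.Tendsto
      (fun Q : ℕ => (({γ : ℝ | γ ∈ F Q ∧ Int.fract γ ∈ I}.ncard : ℕ) : ℝ) / ((F Q).ncard : ℝ))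
      Filter.atTop (nhds (MeasureTheory.volume.real I))

/-- The sequence `x 1, x 2, …` lists the elements of the increasing sets `F 1 ⊆ F 2 ⊆ …`
successively: for every `Q`, its first `#(F Q)` terms are the elements of `F Q`, each once. -/
def ListsSuccessively (x : ℕ → ℝ) (F : ℕ → Set ℝ) : Prop :=
  ∀ Q : ℕ, Set.BijOn x (Set.Icc 1 (F Q).ncard) (F Q)

open Finset Filter ArithmeticFunction

/-! For a single denominator `q`, Möbius inversion shows that the number of reduced `a / q` with
fractional part in `I` is `|I| φ(q) + O(2 ^ ω(q))`, and `2 ^ ω(q) = o(φ(q))`. Summing over the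
admissible `q` keeps the error negligible as soon as `∑ φ(q)` diverges, so no asymptotic formula for
that sum is needed.

For the sequence, passing from `Q` to `Q + 1` adds at most `Q + 1` fractions. The admissible
denominators have positive lower density and `φ → ∞`, so `Q = o(#F_Q)`. This gives both the
divergence and the negligible growth that allows interpolation between consecutive `#F_Q`. -/

/-! ### The divisor bound `2 ^ ω(n) = o(φ(n))`. -/

theorem sixteen_pow_mul_prod_le (s : Finset ℕ) (hs : ∀ p ∈ s, p.Prime) :
    16 ^ s.card * ∏ p ∈ s, p ≤ 96 * (∏ p ∈ s, (p - 1)) ^ 4 := by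
  -- For primes `p ≥ 5`, `16 p ≤ (p - 1) ^ 4`. The primes 2 and 3 need extra factors 32 and 3,
  -- whence 96.
  have h1 : 16 ^ s.card * ∏ p ∈ s, p ≤
      ∏ p ∈ s, ((if p = 2 then 32 else 1) * (if p = 3 then 3 else 1) * (p - 1) ^ 4) := by
    rw [← prod_const, ← prod_mul_distrib]
    refine prod_le_prod' fun p hp => ?_
    have hp2 := (hs p hp).two_le
    obtain rfl | h2 := eq_or_ne p 2
    · norm_num
    obtain rfl | h3 := eq_or_ne p 3
    · norm_num
    obtain ⟨t, rfl⟩ : ∃ t, p = t + 4 := ⟨p - 4, by omega⟩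
    have h4 : t ≠ 0 := by
      rintro rfl
      exact absurd (hs _ hp) (by norm_num)
    have h5 : 1 ≤ t := Nat.one_le_iff_ne_zero.mpr h4
    simp only [h2, h3, if_false, one_mul, show t + 4 - 1 = t + 3 by omega]
    have h6 : 4 ^ 3 ≤ (t + 3) ^ 3 := Nat.pow_le_pow_left (by omega) 3
    nlinarith
  refine h1.trans ?_
  rw [prod_mul_distrib, prod_mul_distrib, prod_ite_eq', prod_ite_eq', prod_pow]
  gcongr
  split_ifs <;> norm_num

theorem mul_sixteen_pow_card_primeFactors_le (n : ℕ) (hn : n ≠ 0) :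
    n * 16 ^ n.primeFactors.card ≤ 96 * n.totient ^ 4 := by
  have h := sixteen_pow_mul_prod_le n.primeFactors fun p hp => Nat.prime_of_mem_primeFactors hp
  have h2 := Nat.totient_mul_prod_primeFactors n
  have h3 : ∏ p ∈ n.primeFactors, p ≤ n :=
    Nat.le_of_dvd (Nat.pos_of_ne_zero hn) (Nat.prod_primeFactors_dvd n)
  have h4 : 0 < ∏ p ∈ n.primeFactors, p :=
    prod_pos fun p hp => (Nat.prime_of_mem_primeFactors hp).pos
  generalize (∏ p ∈ n.primeFactors, p) = R at *
  generalize (∏ p ∈ n.primeFactors, (p - 1)) = P at *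
  generalize n.primeFactors.card = w at *
  -- With `R` the radical of `n`, `φ(n) R = n P`; multiplying by `R ^ 4` avoids division.
  refine Nat.le_of_mul_le_mul_right ?_ (pow_pos h4 4)
  calc n * 16 ^ w * R ^ 4 = n * R ^ 3 * (16 ^ w * R) := by ring
    _ ≤ n * n ^ 3 * (96 * P ^ 4) := by gcongr
    _ = 96 * (n * P) ^ 4 := by ring
    _ = 96 * n.totient ^ 4 * R ^ 4 := by rw [← h2]; ring

theorem isLittleO_two_pow_card_primeFactors_totient :
    (fun n : ℕ => (2 : ℝ) ^ n.primeFactors.card) =o[atTop] fun n : ℕ => (n.totient : ℝ) := by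
  rw [Asymptotics.isLittleO_iff]
  intro c hc
  filter_upwards [eventually_gt_atTop 0, eventually_ge_atTop ⌈96 / c ^ 4⌉₊] with n hn hn2
  have h := mul_sixteen_pow_card_primeFactors_le n hn.ne'
  have h' : (n : ℝ) * 16 ^ n.primeFactors.card ≤ 96 * (n.totient : ℝ) ^ 4 := by exact_mod_cast h
  have h2 : 96 / c ^ 4 ≤ n := Nat.ceil_le.mp hn2
  rw [div_le_iff₀ (by positivity)] at h2
  rw [Real.norm_of_nonneg (by positivity), Real.norm_of_nonneg (by positivity)]
  refine le_of_pow_le_pow_left₀ (n := 4) (by norm_num) (by positivity) ?_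
  rw [← pow_mul, mul_comm _ 4, pow_mul, mul_pow]
  norm_num
  have h3 : (96 : ℝ) * 16 ^ n.primeFactors.card ≤ 96 * (c ^ 4 * (n.totient : ℝ) ^ 4) := by
    calc (96 : ℝ) * 16 ^ n.primeFactors.card ≤ (n * c ^ 4) * 16 ^ n.primeFactors.card := by gcongr
      _ = c ^ 4 * (n * 16 ^ n.primeFactors.card) := by ring
      _ ≤ c ^ 4 * (96 * (n.totient : ℝ) ^ 4) := by gcongr
      _ = _ := by ring
  linarith

theorem tendsto_totient_atTop : Tendsto (fun n : ℕ => (n.totient : ℝ)) atTop atTop := by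
  have h : (fun _ : ℕ => (1 : ℝ)) =o[atTop] fun n : ℕ => (n.totient : ℝ) :=
    Asymptotics.IsBigO.trans_isLittleO
      (Asymptotics.IsBigO.of_bound 1 (Eventually.of_forall fun n => by
        simpa using one_le_pow₀ (one_le_two : (1 : ℝ) ≤ 2)))
      isLittleO_two_pow_card_primeFactors_totient
  simpa using (Asymptotics.isLittleO_one_left_iff ℝ).mp h

/-! ### Möbius count of integers coprime to `q`. -/

theorem sum_divisors_moebius_eq (n : ℕ) :
    ∑ d ∈ n.divisors, moebius d = if n = 1 then 1 else 0 := by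
  rw [← coe_zeta_mul_apply, coe_zeta_mul_moebius, one_apply]

theorem card_coprime_Ioc (q X : ℕ) (hq : q ≠ 0) :
    (#{a ∈ Ioc 0 X | a.Coprime q} : ℤ) = ∑ d ∈ q.divisors, moebius d * (X / d : ℕ) := by
  have h1 : (#{a ∈ Ioc 0 X | a.Coprime q} : ℤ) =
      ∑ a ∈ Ioc 0 X, ∑ d ∈ q.divisors, if d ∣ a then moebius d else 0 := by
    rw [card_filter, Nat.cast_sum]
    refine sum_congr rfl fun a _ => ?_
    rw [← sum_filter, show q.divisors.filter (· ∣ a) = (a.gcd q).divisors by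
      ext d
      simp only [mem_filter, Nat.mem_divisors, Nat.dvd_gcd_iff, ne_eq, Nat.gcd_eq_zero_iff]
      tauto, sum_divisors_moebius_eq]
    push_cast
    rfl
  rw [h1, sum_comm]
  refine sum_congr rfl fun d _ => ?_
  rw [← sum_filter, sum_const, Nat.Ioc_filter_dvd_card_eq_div]
  simp [mul_comm]

theorem totient_eq_sum_moebius (q : ℕ) (hq : q ≠ 0) :
    (q.totient : ℝ) = ∑ d ∈ q.divisors, (moebius d : ℝ) * ((q : ℝ) / d) := by
  have h := card_coprime_Ioc q q hq
  have h2 : #{a ∈ Ioc 0 q | a.Coprime q} = q.totient := by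
    rw [← Nat.filter_coprime_Ico_eq_totient q 1]
    congr 1
    ext a
    simp only [mem_filter, mem_Ioc, mem_Ico, Nat.coprime_comm]
    omega
  rw [h2] at h
  have h3 : (q.totient : ℝ) = ((q.totient : ℤ) : ℝ) := by simp
  rw [h3, h, Int.cast_sum]
  refine sum_congr rfl fun d hd => ?_
  rw [Int.cast_mul, Int.cast_natCast, Nat.cast_div (Nat.dvd_of_mem_divisors hd)]
  exact_mod_cast (Nat.pos_of_mem_divisors hd).ne'

theorem sum_abs_moebius_divisors (q : ℕ) (hq : q ≠ 0) :
    ∑ d ∈ q.divisors, |(moebius d : ℝ)| = 2 ^ q.primeFactors.card := by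
  have h1 : ∀ d, |(moebius d : ℝ)| = if Squarefree d then 1 else 0 := fun d => by
    rw [← Int.cast_abs, abs_moebius]
    split_ifs <;> simp
  simp_rw [h1]
  rw [← sum_filter, Nat.sum_divisors_filter_squarefree hq]
  simp [UniqueFactorizationMonoid.primeFactors_eq_natPrimeFactors]

/-- Both terms are Möbius sums over `d ∣ q`, with `⌊t q / d⌋` against `t q / d`. Each squarefree `d`
costs at most 1, and there are `2 ^ ω(q)` of them. -/
theorem abs_card_coprime_Ioc_floor_sub_le (q : ℕ) (hq : q ≠ 0) (t : ℝ) (ht : 0 ≤ t) :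
    |(#{a ∈ Ioc 0 ⌊t * q⌋₊ | a.Coprime q} : ℝ) - t * q.totient| ≤ 2 ^ q.primeFactors.card := by
  have h := card_coprime_Ioc q ⌊t * q⌋₊ hq
  have h3 : (#{a ∈ Ioc 0 ⌊t * q⌋₊ | a.Coprime q} : ℝ) =
    ((#{a ∈ Ioc 0 ⌊t * q⌋₊ | a.Coprime q} : ℤ) : ℝ) := by simp
  rw [h3, h, totient_eq_sum_moebius q hq, mul_sum, ← sum_abs_moebius_divisors q hq]
  simp only [Int.cast_sum, Int.cast_mul, Int.cast_natCast]
  rw [← sum_sub_distrib]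
  refine (abs_sum_le_sum_abs _ _).trans (sum_le_sum fun d hd => ?_)
  rw [show (moebius d : ℝ) * (⌊t * q⌋₊ / d : ℕ) - t * (moebius d * (q / d)) =
    moebius d * ((⌊t * q⌋₊ / d : ℕ) - t * q / d) by ring, abs_mul]
  refine mul_le_of_le_one_right (abs_nonneg _) ?_
  rw [← Nat.floor_div_natCast, abs_le]
  have h4 : 0 ≤ t * q / d := by positivity
  constructor
  · linarith [Nat.lt_floor_add_one (t * q / d)]
  · linarith [Nat.floor_le h4]

/-! ### Density of `k`-free integers in a progression. -/

theorem card_filter_dvd_add_mul_le {c m d : ℕ} (hd : 0 < d) (hdm : d.Coprime m) (J : ℕ) :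
    #{j ∈ range J | d ∣ c + m * j} ≤ J / d + 1 := by
  obtain h | ⟨i, hi⟩ := ({j ∈ range J | d ∣ c + m * j} : Finset ℕ).eq_empty_or_nonempty
  · simp [h]
  have hi' := (mem_filter.mp hi).2
  calc #{j ∈ range J | d ∣ c + m * j} ≤ #{j ∈ range J | j ≡ i [MOD d]} := by
        refine card_le_card (monotone_filter_right _ fun j _ hj => ?_)
        have h1 : c + m * j ≡ c + m * i [MOD d] :=
          ((Nat.modEq_zero_iff_dvd.mpr hj).trans (Nat.modEq_zero_iff_dvd.mpr hi').symm)
        exact Nat.ModEq.cancel_left_of_coprime hdm (Nat.ModEq.add_left_cancel' c h1)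
    _ = J.count (· ≡ i [MOD d]) := (Nat.count_eq_card_filter_range _ _).symm
    _ ≤ J / d + 1 := by
        rw [Nat.count_modEq_card _ hd]
        gcongr
        split_ifs <;> norm_num

theorem sum_Icc_two_inv_sq_le (D : ℕ) : ∑ d ∈ Icc 2 D, ((d : ℝ) ^ 2)⁻¹ ≤ 3 / 4 := by
  obtain h | h := lt_or_ge D 2
  · rw [Icc_eq_empty (by omega)]
    norm_num
  · rw [← Finset.insert_Icc_add_one_left_eq_Icc h, sum_insert (by simp),
      show Icc (2 + 1) D = Ioc 2 D by ext; simp; omega]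
    have h1 := sum_Ioc_inv_sq_le_sub (α := ℝ) two_ne_zero h
    have h2 : (0 : ℝ) ≤ (D : ℝ)⁻¹ := by positivity
    push_cast at h1 ⊢
    linarith

/-- Union bound over square divisors `d ^ 2` with `d ≥ 2`: each removes at most `J / d ^ 2 + 1`
indices, and none if `d` shares a factor with `m`. Even over all `d`, not just primes, `∑ 1 / d ^ 2
≤ 3 / 4` leaves a quarter. -/
theorem card_squarefree_add_mul_ge {c m : ℕ} (hc : 0 < c) (hcm : c.Coprime m) (J : ℕ) :
    (J : ℝ) / 4 - Nat.sqrt (c + m * J) ≤ #{j ∈ range J | Squarefree (c + m * j)} := by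
  have h1 : ({j ∈ range J | ¬ Squarefree (c + m * j)} : Finset ℕ) ⊆
      (Icc 2 (Nat.sqrt (c + m * J))).biUnion fun d => {j ∈ range J | d ^ 2 ∣ c + m * j} := by
    intro j hj
    rw [mem_filter, mem_range, Nat.squarefree_iff_prime_squarefree] at hj
    push Not at hj
    obtain ⟨hj, p, hp, hpj⟩ := hj
    rw [mem_biUnion]
    refine ⟨p, mem_Icc.mpr ⟨hp.two_le, Nat.le_sqrt.mpr ?_⟩, by simp [hj, sq, hpj]⟩
    calc p * p ≤ c + m * j := Nat.le_of_dvd (by omega) hpj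
      _ ≤ c + m * J := by gcongr
  have h2 : (#{j ∈ range J | ¬ Squarefree (c + m * j)} : ℝ) ≤
      ∑ d ∈ Icc 2 (Nat.sqrt (c + m * J)), ((J : ℝ) * ((d : ℝ) ^ 2)⁻¹ + 1) := by
    have h3 := (card_le_card h1).trans card_biUnion_le
    refine (Nat.cast_le.mpr h3).trans ?_
    rw [Nat.cast_sum]
    refine sum_le_sum fun d hd => ?_
    have hd2 := (mem_Icc.mp hd).1
    by_cases hdm : (d ^ 2).Coprime m
    · refine (Nat.cast_le.mpr (card_filter_dvd_add_mul_le (by positivity) hdm J)).trans ?_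
      rw [Nat.cast_add, Nat.cast_one, ← div_eq_mul_inv]
      gcongr
      exact_mod_cast (Nat.cast_div_le (α := ℝ) (m := J) (n := d ^ 2))
    · rw [filter_false_of_mem]
      · simp only [card_empty, Nat.cast_zero]
        positivity
      · intro j _ hj
        refine hdm (Nat.Coprime.coprime_dvd_left hj ?_)
        simpa using hcm
  have h4 := sum_Icc_two_inv_sq_le (Nat.sqrt (c + m * J))
  rw [sum_add_distrib, ← mul_sum] at h2
  have h5 : ∑ d ∈ Icc 2 (Nat.sqrt (c + m * J)), (1 : ℝ) ≤ Nat.sqrt (c + m * J) := by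
    simp
  have h6 := card_filter_add_card_filter_not (s := range J) (fun j => Squarefree (c + m * j))
  rw [card_range] at h6
  have h7 : (#{j ∈ range J | Squarefree (c + m * j)} : ℝ) +
    #{j ∈ range J | ¬ Squarefree (c + m * j)} = J := by exact_mod_cast h6
  have h8 : (J : ℝ) * ∑ d ∈ Icc 2 (Nat.sqrt (c + m * J)), ((d : ℝ) ^ 2)⁻¹ ≤ J * (3 / 4) := by
    gcongr
  linarith

theorem Squarefree.isKFree {k n : ℕ} (hk : 2 ≤ k) (hn : Squarefree n) : IsKFree k n :=
  fun _ hp _ h => (Nat.squarefree_iff_prime_squarefree.mp hn) _ hp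
    (by simpa only [sq] using (pow_dvd_pow _ hk).trans h)

open Classical in
/-- The `k`-free integers congruent to `b` modulo `m` have positive lower density. -/
theorem exists_pos_eventually_le_card_isKFree (k m : ℕ) (b : ℤ) (hk : 2 ≤ k) (hm : 1 ≤ m)
    (hb : Int.gcd b (m : ℤ) = 1) :
    ∃ δ : ℝ, 0 < δ ∧ ∀ᶠ Q : ℕ in atTop,
      δ * Q ≤ #{q ∈ range (Q + 1) | IsKFree k q ∧ (q : ℤ) ≡ b [ZMOD (m : ℤ)]} := by
  obtain ⟨c, hc0, hcm, hcb⟩ : ∃ c : ℕ, 0 < c ∧ c.Coprime m ∧ (c : ℤ) ≡ b [ZMOD (m : ℤ)] := by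
    have h1 : 0 ≤ b % m := Int.emod_nonneg _ (by omega)
    have h2 : (((b % m).toNat + m : ℕ) : ℤ) ≡ b [ZMOD (m : ℤ)] := by
      push_cast
      rw [Int.toNat_of_nonneg h1]
      simp [Int.ModEq]
    refine ⟨(b % m).toNat + m, by omega, ?_, h2⟩
    rw [← Nat.isCoprime_iff_coprime, Int.isCoprime_iff_gcd_eq_one, ← Int.gcd_emod, h2.eq,
      Int.gcd_emod, hb]
  have hm0 : (0 : ℝ) < m := by exact_mod_cast hm
  -- With `J ≥ Q / (2 m)`, the main term `J / 4` is at least `Q / (8 m)`, and the square root takes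
  -- at most half of that.
  refine ⟨1 / (16 * m), by positivity, ?_⟩
  filter_upwards [eventually_ge_atTop (2 * m + 2 * c), eventually_ge_atTop ((16 * m) ^ 2)]
    with Q hQ1 hQ2
  set J := (Q - c) / m with hJ
  have hJQ : c + m * J ≤ Q := by
    have := Nat.mul_div_le (Q - c) m
    rw [← hJ] at this
    omega
  have hJ2 : (Q : ℝ) / 2 ≤ m * J := by
    have h1 := Nat.lt_mul_div_succ (Q - c) (show 0 < m by omega)
    rw [← hJ] at h1
    have h2 : Q ≤ 2 * (m * J) := by
      rw [mul_add] at h1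
      omega
    have h3 : (Q : ℝ) ≤ 2 * (m * J) := by exact_mod_cast h2
    linarith
  have hs : (Nat.sqrt (c + m * J) : ℝ) * (16 * m) ≤ Q := by
    have h1 : Nat.sqrt (c + m * J) ≤ Nat.sqrt Q := Nat.sqrt_le_sqrt hJQ
    have h2 : 16 * m ≤ Nat.sqrt Q := Nat.le_sqrt'.mpr hQ2
    have h3 : Nat.sqrt (c + m * J) * (16 * m) ≤ Q :=
      (Nat.mul_le_mul h1 h2).trans (Nat.sqrt_le Q)
    exact_mod_cast h3
  have hcard : #{j ∈ range J | Squarefree (c + m * j)} ≤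
      #{q ∈ range (Q + 1) | IsKFree k q ∧ (q : ℤ) ≡ b [ZMOD (m : ℤ)]} := by
    refine card_le_card_of_injOn (fun j => c + m * j) ?_ ?_
    · intro j hj
      simp only [coe_filter, mem_range, Set.mem_ofPred_eq] at hj ⊢
      refine ⟨?_, hj.2.isKFree hk, ?_⟩
      · have : m * j ≤ m * J := Nat.mul_le_mul_left m hj.1.le
        omega
      · push_cast
        refine Int.ModEq.trans ?_ hcb
        simp [Int.ModEq]
    · intro i _ j _ hij
      simpa [show m ≠ 0 by omega] using hij
  have h1 := card_squarefree_add_mul_ge hc0 hcm J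
  have h2 : (#{j ∈ range J | Squarefree (c + m * j)} : ℝ) ≤
      #{q ∈ range (Q + 1) | IsKFree k q ∧ (q : ℤ) ≡ b [ZMOD (m : ℤ)]} := by exact_mod_cast hcard
  refine le_trans ?_ (h1.trans h2)
  rw [div_mul_eq_mul_div, one_mul, div_le_iff₀ (by positivity), sub_mul]
  nlinarith

/-! ### Reduced fractions with a fixed denominator. -/

open Classical in
/-- The numerators of the reduced fractions in `(0, 1]` with denominator `q` whose fractional part
lies in `I`. -/
noncomputable def reducedNumerators (q : ℕ) (I : Set ℝ) : Finset ℕ :=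
  {a ∈ Ioc 0 q | a.Coprime q ∧ Int.fract ((a : ℝ) / q) ∈ I}

theorem card_reducedNumerators_univ (q : ℕ) : #(reducedNumerators q Set.univ) = q.totient := by
  rw [← Nat.filter_coprime_Ico_eq_totient q 1]
  congr 1
  ext a
  simp only [reducedNumerators, mem_filter, mem_Ioc, mem_Ico, Nat.coprime_comm, Set.mem_univ,
    and_true]
  omega

theorem card_reducedNumerators_le (q : ℕ) (I : Set ℝ) :
    #(reducedNumerators q I) ≤ q.totient := by
  classical
  rw [← card_reducedNumerators_univ]
  refine card_le_card fun a ha => ?_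
  simp only [reducedNumerators, mem_filter, Set.mem_univ, and_true] at ha ⊢
  exact ⟨ha.1, ha.2.1⟩

/-- Up to one endpoint on each side, the numerators are the integers coprime to `q` in `(α q, β q]`,
a difference of two initial segments. -/
theorem abs_card_reducedNumerators_sub_le (q : ℕ) (hq : q ≠ 0) (I : Set ℝ) (hI : I.OrdConnected)
    (hI1 : I ⊆ Set.Ico 0 1) :
    |(#(reducedNumerators q I) : ℝ) - MeasureTheory.volume.real I * q.totient| ≤
      4 * 2 ^ q.primeFactors.card := by
  classical
  obtain rfl | hne := I.eq_empty_or_nonempty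
  · simp [reducedNumerators]
  have hbb : BddBelow I := ⟨0, fun x hx => (hI1 hx).1⟩
  have hba : BddAbove I := ⟨1, fun x hx => (hI1 hx).2.le⟩
  have hIoo : Set.Ioo (sInf I) (sSup I) ⊆ I :=
    IsConnected.Ioo_csInf_csSup_subset ⟨hne, hI.isPreconnected⟩ hbb hba
  have hIcc : I ⊆ Set.Icc (sInf I) (sSup I) := subset_Icc_csInf_csSup hbb hba
  have ha0 : 0 ≤ sInf I := le_csInf hne fun x hx => (hI1 hx).1
  have hb1 : sSup I ≤ 1 := csSup_le hne fun x hx => (hI1 hx).2.le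
  have hab : sInf I ≤ sSup I := csInf_le_csSup hne hbb hba
  generalize sInf I = α at *
  generalize sSup I = β at *
  have hvol : MeasureTheory.volume.real I = β - α := by
    apply le_antisymm
    · rw [← Real.volume_real_Icc_of_le hab]
      exact MeasureTheory.measureReal_mono hIcc (by simp)
    · rw [← Real.volume_real_Ioo_of_le hab]
      exact MeasureTheory.measureReal_mono hIoo
        ((MeasureTheory.measure_mono hIcc).trans_lt (by simp)).ne
  rw [hvol]
  have hone : (1 : ℝ) ≤ 2 ^ q.primeFactors.card := one_le_pow₀ one_le_two
  -- Only for `q = 1` does the fraction `q / q` occur, whose fractional part is 0 instead of itself.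
  obtain rfl | hq1 := eq_or_ne q 1
  · have h1 : #(reducedNumerators 1 I) ≤ 1 := by simpa using card_reducedNumerators_le 1 I
    have h2 : (#(reducedNumerators 1 I) : ℝ) ≤ 1 := by exact_mod_cast h1
    have h3 : (0 : ℝ) ≤ #(reducedNumerators 1 I) := by positivity
    rw [Nat.totient_one, Nat.cast_one, abs_le]
    constructor <;> linarith
  have hq0 : (0 : ℝ) < q := by positivity
  have hA := abs_card_coprime_Ioc_floor_sub_le q hq α ha0
  have hB := abs_card_coprime_Ioc_floor_sub_le q hq β (ha0.trans hab)
  set A : Finset ℕ := {a ∈ Ioc 0 ⌊α * q⌋₊ | a.Coprime q} with hAdef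
  set B : Finset ℕ := {a ∈ Ioc 0 ⌊β * q⌋₊ | a.Coprime q} with hBdef
  have hαq : 0 ≤ α * q := by positivity
  have hβq : 0 ≤ β * q := mul_nonneg (ha0.trans hab) hq0.le
  have hAB : A ⊆ B := by
    refine filter_subset_filter _ (Ioc_subset_Ioc_right (Nat.floor_le_floor ?_))
    gcongr
  have hfr : ∀ a : ℕ, 0 < a → a ≤ q → a.Coprime q → Int.fract ((a : ℝ) / q) = a / q := by
    intro a _ ha hc
    rw [Int.fract_eq_self, div_lt_one hq0]
    refine ⟨by positivity, ?_⟩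
    refine Nat.cast_lt.mpr (lt_of_le_of_ne ha ?_)
    rintro rfl
    exact hq1 (by simpa using hc)
  have h1 : reducedNumerators q I ⊆ insert ⌊α * q⌋₊ (B \ A) := by
    intro a ha
    simp only [reducedNumerators, mem_filter, mem_Ioc] at ha
    obtain ⟨⟨ha, haq⟩, hc, hI'⟩ := ha
    rw [hfr a ha haq hc] at hI'
    obtain ⟨h1, h2⟩ := hIcc hI'
    rw [le_div_iff₀ hq0] at h1
    rw [div_le_iff₀ hq0] at h2
    rw [mem_insert, Finset.mem_sdiff]
    by_cases haA : a ∈ A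
    · left
      simp only [hAdef, mem_filter, mem_Ioc] at haA
      have h3 := (Nat.le_floor_iff hαq).mp haA.1.2
      rw [le_antisymm h1 h3, Nat.floor_natCast]
    · right
      refine ⟨?_, haA⟩
      simp only [hBdef, mem_filter, mem_Ioc]
      exact ⟨⟨ha, Nat.le_floor h2⟩, hc⟩
  have h2 : B \ A ⊆ insert ⌊β * q⌋₊ (reducedNumerators q I) := by
    intro a ha
    simp only [hAdef, hBdef, Finset.mem_sdiff, mem_filter, mem_Ioc, not_and, and_imp] at ha
    obtain ⟨⟨⟨ha, haB⟩, hc⟩, haA⟩ := ha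
    rw [Nat.le_floor_iff hβq] at haB
    have h3 : α * q < a := by
      by_contra h
      exact haA ha (Nat.le_floor (not_lt.mp h)) hc
    rw [mem_insert]
    obtain h4 | h4 := haB.eq_or_lt
    · left
      rw [← h4, Nat.floor_natCast]
    · right
      have haq : a ≤ q := by
        have : (a : ℝ) ≤ q := haB.trans (mul_le_of_le_one_left hq0.le hb1)
        exact_mod_cast this
      simp only [reducedNumerators, mem_filter, mem_Ioc]
      refine ⟨⟨ha, haq⟩, hc, ?_⟩
      rw [hfr a ha haq hc]
      exact hIoo ⟨(lt_div_iff₀ hq0).mpr h3, (div_lt_iff₀ hq0).mpr h4⟩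
  have h3 := (card_le_card h1).trans (card_insert_le _ _)
  have h4 := (card_le_card h2).trans (card_insert_le _ _)
  have h5 : #(B \ A) + #A = #B := card_sdiff_add_card_eq_card hAB
  have h3' : (#(reducedNumerators q I) : ℝ) ≤ #(B \ A) + 1 := by exact_mod_cast h3
  have h4' : (#(B \ A) : ℝ) ≤ #(reducedNumerators q I) + 1 := by exact_mod_cast h4
  have h5' : (#(B \ A) : ℝ) + #A = #B := by exact_mod_cast h5
  rw [abs_le] at *
  constructor <;> linarith

/-! ### Equidistribution of the Farey sets. -/

open Classical in
theorem ncard_kFreeFarey_fract_mem (k m : ℕ) (b : ℤ) (I : Set ℝ) (Q : ℕ) :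
    {γ : ℝ | γ ∈ kFreeFarey k m b Q ∧ Int.fract γ ∈ I}.ncard =
      ∑ q ∈ range (Q + 1),
        if IsKFree k q ∧ (q : ℤ) ≡ b [ZMOD (m : ℤ)] then #(reducedNumerators q I) else 0 := by
  have h : {γ : ℝ | γ ∈ kFreeFarey k m b Q ∧ Int.fract γ ∈ I} =
      (fun p : (_ : ℕ) × ℕ => (p.2 : ℝ) / p.1) ''
        (({q ∈ range (Q + 1) | IsKFree k q ∧ (q : ℤ) ≡ b [ZMOD (m : ℤ)]}.sigma
          fun q => reducedNumerators q I : Finset ((_ : ℕ) × ℕ)) : Set ((_ : ℕ) × ℕ)) := by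
    ext γ
    simp only [kFreeFarey, Set.mem_ofPred_eq, Set.mem_image, SetLike.mem_coe, mem_sigma, mem_filter,
      mem_range, reducedNumerators, mem_Ioc, Nat.coprime_iff_gcd_eq_one]
    constructor
    · rintro ⟨⟨a, q, ha, haq, hqQ, hg, hf, hc, rfl⟩, hI⟩
      exact ⟨⟨q, a⟩, ⟨⟨Nat.lt_succ_of_le hqQ, hf, hc⟩, ⟨ha, haq⟩, hg, hI⟩, rfl⟩
    · rintro ⟨⟨q, a⟩, ⟨⟨hqQ, hf, hc⟩, ⟨ha, haq⟩, hg, hI⟩, rfl⟩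
      exact ⟨⟨a, q, ha, haq, Nat.le_of_lt_succ hqQ, hg, hf, hc, rfl⟩, hI⟩
  rw [h, Set.InjOn.ncard_image, Set.ncard_coe_finset, card_sigma, sum_filter]
  rintro ⟨q, a⟩ h1 ⟨q', a'⟩ h2 heq
  simp only [SetLike.mem_coe, mem_sigma, reducedNumerators, mem_filter, mem_Ioc] at h1 h2
  obtain ⟨-, ⟨ha, haq⟩, hc, -⟩ := h1
  obtain ⟨-, ⟨ha', haq'⟩, hc', -⟩ := h2
  have hq : (q : ℝ) ≠ 0 := by norm_cast; omega
  have hq' : (q' : ℝ) ≠ 0 := by norm_cast; omega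
  simp only at heq
  rw [div_eq_div_iff hq hq'] at heq
  have heq' : a * q' = a' * q := by exact_mod_cast heq
  have hqq : q = q' := Nat.dvd_antisymm
    (hc.symm.dvd_of_dvd_mul_left (heq' ▸ dvd_mul_left q a'))
    (hc'.symm.dvd_of_dvd_mul_left (heq' ▸ dvd_mul_left q' a))
  subst hqq
  have : a = a' := Nat.eq_of_mul_eq_mul_right (by omega) heq'
  rw [this]

open Classical in
theorem ncard_kFreeFarey (k m : ℕ) (b : ℤ) (Q : ℕ) :
    (kFreeFarey k m b Q).ncard =
      ∑ q ∈ range (Q + 1),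
        if IsKFree k q ∧ (q : ℤ) ≡ b [ZMOD (m : ℤ)] then q.totient else 0 := by
  simpa [card_reducedNumerators_univ] using ncard_kFreeFarey_fract_mem k m b Set.univ Q

theorem isLittleO_natCast_ncard_kFreeFarey (k m : ℕ) (b : ℤ) (hk : 2 ≤ k) (hm : 1 ≤ m)
    (hb : Int.gcd b (m : ℤ) = 1) :
    (fun Q : ℕ => (Q : ℝ)) =o[atTop] fun Q => ((kFreeFarey k m b Q).ncard : ℝ) := by
  classical
  obtain ⟨δ, hδ, hev⟩ := exists_pos_eventually_le_card_isKFree k m b hk hm hb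
  rw [Asymptotics.isLittleO_iff]
  intro c hc
  obtain ⟨K, hK⟩ := eventually_atTop.mp
    (tendsto_totient_atTop.eventually_ge_atTop (2 / (c * δ)))
  filter_upwards [hev, eventually_ge_atTop ⌈2 * K / δ⌉₊] with Q hQ hQ2
  have hQ2' : 2 * K / δ ≤ Q := Nat.ceil_le.mp hQ2
  rw [div_le_iff₀ hδ] at hQ2'
  rw [Real.norm_of_nonneg (by positivity), Real.norm_of_nonneg (by positivity)]
  set S : Finset ℕ := {q ∈ range (Q + 1) | IsKFree k q ∧ (q : ℤ) ≡ b [ZMOD (m : ℤ)]} with hS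
  -- Discarding `q < K` leaves at least `δ Q / 2` denominators, each with `φ(q) ≥ 2 / (c δ)`.
  have h1 : #S ≤ #{q ∈ S | K ≤ q} + K := by
    rw [← card_filter_add_card_filter_not (s := S) (fun q => K ≤ q)]
    gcongr
    calc _ ≤ #(range K) := card_le_card fun q hq => by simp at hq ⊢; exact hq.2
      _ = K := card_range K
  have h1' : (#S : ℝ) ≤ #{q ∈ S | K ≤ q} + K := by exact_mod_cast h1
  have h2 : (#{q ∈ S | K ≤ q} : ℝ) * (2 / (c * δ)) ≤ ((kFreeFarey k m b Q).ncard : ℝ) := by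
    rw [ncard_kFreeFarey, ← sum_filter, ← hS, Nat.cast_sum, ← nsmul_eq_mul]
    refine (card_nsmul_le_sum _ (fun q => (q.totient : ℝ)) _ fun q hq =>
      hK q (mem_filter.mp hq).2).trans ?_
    exact sum_le_sum_of_subset_of_nonneg (filter_subset _ _) fun _ _ _ => by positivity
  have h3 : δ * Q / 2 ≤ #{q ∈ S | K ≤ q} := by linarith
  calc (Q : ℝ) = c * (δ * Q / 2 * (2 / (c * δ))) := by field_simp
    _ ≤ c * (#{q ∈ S | K ≤ q} * (2 / (c * δ))) := by gcongr
    _ ≤ _ := by gcongr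

theorem tendsto_ncard_kFreeFarey (k m : ℕ) (b : ℤ) (hk : 2 ≤ k) (hm : 1 ≤ m)
    (hb : Int.gcd b (m : ℤ) = 1) :
    Tendsto (fun Q => ((kFreeFarey k m b Q).ncard : ℝ)) atTop atTop := by
  have h := (isLittleO_natCast_ncard_kFreeFarey k m b hk hm hb).bound one_pos
  refine tendsto_atTop_mono' _ ?_ tendsto_natCast_atTop_atTop
  filter_upwards [h] with Q hQ
  simpa using hQ

theorem setsUniformlyDistributedModOne_kFreeFarey (k m : ℕ) (b : ℤ) (hk : 2 ≤ k) (hm : 1 ≤ m)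
    (hb : Int.gcd b (m : ℤ) = 1) :
    SetsUniformlyDistributedModOne (kFreeFarey k m b) := by
  classical
  intro I hI hI1
  have htop := tendsto_ncard_kFreeFarey k m b hk hm hb
  set P : ℕ → Prop := fun q => IsKFree k q ∧ (q : ℤ) ≡ b [ZMOD (m : ℤ)] with hP
  set g : ℕ → ℝ := fun q => if P q then (q.totient : ℝ) else 0 with hg
  set f : ℕ → ℝ := fun q => if P q then
    (#(reducedNumerators q I) : ℝ) - MeasureTheory.volume.real I * q.totient else 0 with hf
  have hgsum : ∀ Q, ((kFreeFarey k m b Q).ncard : ℝ) = ∑ q ∈ range (Q + 1), g q := fun Q => by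
    rw [ncard_kFreeFarey]
    push_cast
    rfl
  have hfsum : ∀ Q, (({γ : ℝ | γ ∈ kFreeFarey k m b Q ∧ Int.fract γ ∈ I}.ncard : ℕ) : ℝ) =
      ∑ q ∈ range (Q + 1), f q +
        MeasureTheory.volume.real I * ((kFreeFarey k m b Q).ncard : ℝ) := fun Q => by
    rw [ncard_kFreeFarey_fract_mem, hgsum, mul_sum, ← sum_add_distrib]
    push_cast
    refine sum_congr rfl fun q _ => ?_
    simp only [hf, hg, hP]
    split_ifs <;> ring
  have hfg : f =o[atTop] g := by
    rw [Asymptotics.isLittleO_iff]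
    intro c hc
    filter_upwards [isLittleO_two_pow_card_primeFactors_totient.bound
      (show 0 < c / 4 by positivity), eventually_ne_atTop 0] with q hq hq0
    rw [Real.norm_of_nonneg (by positivity), Real.norm_of_nonneg (by positivity)] at hq
    simp only [hf, hg]
    split_ifs
    · rw [Real.norm_of_nonneg (show (0 : ℝ) ≤ q.totient by positivity), Real.norm_eq_abs]
      linarith [abs_card_reducedNumerators_sub_le q hq0 I hI hI1]
    · simp
  have hg0 : 0 ≤ g := fun q => by
    simp only [hg]
    split_ifs <;> simp
  have hgt : Tendsto (fun n => ∑ i ∈ range n, g i) atTop atTop := by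
    rw [← tendsto_add_atTop_iff_nat 1]
    simpa only [hgsum] using htop
  -- Little-o passes to partial sums because the weights `g` are nonnegative with divergent sum.
  have ho := (hfg.sum_range hg0 hgt).comp_tendsto (tendsto_add_atTop_nat 1)
  have hlim := ho.tendsto_div_nhds_zero.add_const (MeasureTheory.volume.real I)
  rw [zero_add] at hlim
  refine hlim.congr' ?_
  filter_upwards [htop.eventually_gt_atTop 0] with Q hQ
  rw [hfsum, add_div, mul_div_cancel_right₀ _ hQ.ne', hgsum]
  rfl

/-! ### From the sets to the sequence. -/

theorem ncard_fract_mem_eq_of_bijOn {x : ℕ → ℝ} {F : Set ℝ} {n : ℕ}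
    (hx : Set.BijOn x (Set.Icc 1 n) F) (I : Set ℝ) :
    {j : ℕ | 1 ≤ j ∧ j ≤ n ∧ Int.fract (x j) ∈ I}.ncard =
      {γ : ℝ | γ ∈ F ∧ Int.fract γ ∈ I}.ncard := by
  have h : {γ : ℝ | γ ∈ F ∧ Int.fract γ ∈ I} =
      x '' {j : ℕ | 1 ≤ j ∧ j ≤ n ∧ Int.fract (x j) ∈ I} := by
    ext γ
    constructor
    · rintro ⟨h1, h2⟩
      obtain ⟨j, hj, rfl⟩ := hx.surjOn h1
      exact ⟨j, ⟨hj.1, hj.2, h2⟩, rfl⟩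
    · rintro ⟨j, ⟨h1, h2, h3⟩, rfl⟩
      exact ⟨hx.mapsTo ⟨h1, h2⟩, h3⟩
  have hsub : {j : ℕ | 1 ≤ j ∧ j ≤ n ∧ Int.fract (x j) ∈ I} ⊆ Set.Icc 1 n :=
    fun j hj => ⟨hj.1, hj.2.1⟩
  rw [h, (hx.injOn.mono hsub).ncard_image]

theorem ncard_fract_mem_le_of_le (x : ℕ → ℝ) (I : Set ℝ) {M N : ℕ} (h : M ≤ N) :
    {j : ℕ | 1 ≤ j ∧ j ≤ M ∧ Int.fract (x j) ∈ I}.ncard ≤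
      {j : ℕ | 1 ≤ j ∧ j ≤ N ∧ Int.fract (x j) ∈ I}.ncard ∧
    {j : ℕ | 1 ≤ j ∧ j ≤ N ∧ Int.fract (x j) ∈ I}.ncard ≤
      {j : ℕ | 1 ≤ j ∧ j ≤ M ∧ Int.fract (x j) ∈ I}.ncard + (N - M) := by
  have hfin : ∀ n, {j : ℕ | 1 ≤ j ∧ j ≤ n ∧ Int.fract (x j) ∈ I}.Finite := fun n =>
    (Set.finite_Icc 1 n).subset fun j hj => ⟨hj.1, hj.2.1⟩
  constructor
  · exact Set.ncard_le_ncard (fun j hj => ⟨hj.1, hj.2.1.trans h, hj.2.2⟩) (hfin N)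
  · have h1 : {j : ℕ | 1 ≤ j ∧ j ≤ N ∧ Int.fract (x j) ∈ I} ⊆
        {j : ℕ | 1 ≤ j ∧ j ≤ M ∧ Int.fract (x j) ∈ I} ∪ ((Ioc M N : Finset ℕ) : Set ℕ) := by
      rintro j ⟨h1, h2, h3⟩
      by_cases hj : j ≤ M
      · exact Or.inl ⟨h1, hj, h3⟩
      · exact Or.inr (by simp; omega)
    refine (Set.ncard_le_ncard h1 ((hfin M).union (finite_toSet _))).trans ?_
    refine (Set.ncard_union_le _ _).trans ?_
    rw [Set.ncard_coe_finset, Nat.card_Ioc]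

/-- A sequence listing sets that are uniformly distributed modulo one is uniformly distributed
modulo one, provided that the sets grow by a negligible proportion at each step. -/
theorem SetsUniformlyDistributedModOne.of_listsSuccessively {F : ℕ → Set ℝ} {x : ℕ → ℝ}
    (hF : SetsUniformlyDistributedModOne F) (hx : ListsSuccessively x F)
    (htop : Tendsto (fun Q => (F Q).ncard) atTop atTop)
    (hstep : (fun Q => ((F (Q + 1)).ncard : ℝ) - (F Q).ncard) =o[atTop]
      fun Q => ((F Q).ncard : ℝ)) :
    UniformlyDistributedModOne x := by
  intro I hI hI1
  have hvol0 : 0 ≤ MeasureTheory.volume.real I := MeasureTheory.measureReal_nonneg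
  have hvol1 : MeasureTheory.volume.real I ≤ 1 := by
    have h := MeasureTheory.measureReal_mono (μ := MeasureTheory.volume) hI1 (by simp)
    simpa using h
  have hF' := hF I hI hI1
  generalize MeasureTheory.volume.real I = v at *
  rw [Metric.tendsto_atTop]
  intro ε hε
  obtain ⟨Q₀, hQ₀⟩ := eventually_atTop.mp
    ((hstep.bound (show 0 < ε / 4 by positivity)).and
      (((Metric.tendsto_nhds.mp hF') (ε / 4) (by positivity)).and (htop.eventually_gt_atTop 0)))
  refine ⟨(F Q₀).ncard, fun N hN => ?_⟩
  have hex : ∃ Q, N < (F Q).ncard := (htop.eventually_gt_atTop N).exists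
  obtain ⟨Q, hQ, hQN, hNQ⟩ : ∃ Q, Q₀ ≤ Q ∧ (F Q).ncard ≤ N ∧ N < (F (Q + 1)).ncard := by
    by_contra! hcon
    have : ∀ Q, Q₀ ≤ Q → (F Q).ncard ≤ N := fun Q hQ =>
      Nat.le_induction hN (fun Q hQ ih => hcon Q hQ ih) Q hQ
    obtain ⟨Q, hQ1, hQ2⟩ := ((htop.eventually_gt_atTop N).and (eventually_ge_atTop Q₀)).exists
    exact absurd (this Q hQ2) (by omega)
  obtain ⟨h1, h2, h3⟩ := hQ₀ Q hQ
  obtain ⟨h4, h5⟩ := ncard_fract_mem_le_of_le x I hQN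
  rw [ncard_fract_mem_eq_of_bijOn (hx Q) I] at h4 h5
  generalize {j : ℕ | 1 ≤ j ∧ j ≤ N ∧ Int.fract (x j) ∈ I}.ncard = A at *
  generalize {γ : ℝ | γ ∈ F Q ∧ Int.fract γ ∈ I}.ncard = G at *
  generalize (F Q).ncard = n at *
  generalize (F (Q + 1)).ncard = n' at *
  have hn : (0 : ℝ) < n := by exact_mod_cast h3
  have hnN : (n : ℝ) ≤ N := by exact_mod_cast hQN
  have hNn : (N : ℝ) ≤ n' := by exact_mod_cast hNQ.le
  have hN0 : (0 : ℝ) < N := hn.trans_le hnN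
  have h4' : (G : ℝ) ≤ A := by exact_mod_cast h4
  have h5' : (A : ℝ) ≤ G + (N - n) := by
    rw [← Nat.cast_sub hQN]
    exact_mod_cast h5
  rw [Real.norm_of_nonneg (by linarith), Real.norm_of_nonneg hn.le] at h1
  rw [Real.dist_eq, abs_lt, lt_sub_iff_add_lt, sub_lt_iff_lt_add, lt_div_iff₀ hn,
    div_lt_iff₀ hn] at h2
  rw [Real.dist_eq, abs_lt, lt_sub_iff_add_lt, sub_lt_iff_lt_add, lt_div_iff₀ hN0,
    div_lt_iff₀ hN0]
  -- Equidistribution at `n` and the `N - n` extra terms each cost at most `ε n / 4`, so the total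
  -- error is below `ε N`.
  have h6 : v * n ≤ v * N := by gcongr
  have h7 : v * (N - n) ≤ N - n := mul_le_of_le_one_left (by linarith) hvol1
  have h8 : ε * n ≤ ε * N := by gcongr
  have h9 : 0 < ε * n := by positivity
  constructor <;> nlinarith

theorem isLittleO_ncard_kFreeFarey_succ_sub (k m : ℕ) (b : ℤ) (hk : 2 ≤ k) (hm : 1 ≤ m)
    (hb : Int.gcd b (m : ℤ) = 1) :
    (fun Q => ((kFreeFarey k m b (Q + 1)).ncard : ℝ) - (kFreeFarey k m b Q).ncard) =o[atTop]
      fun Q => ((kFreeFarey k m b Q).ncard : ℝ) := by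
  refine Asymptotics.IsBigO.trans_isLittleO (Asymptotics.IsBigO.of_bound 2 ?_)
    (isLittleO_natCast_ncard_kFreeFarey k m b hk hm hb)
  filter_upwards [eventually_ge_atTop 1] with Q hQ
  have hQ' : (1 : ℝ) ≤ Q := by exact_mod_cast hQ
  rw [ncard_kFreeFarey, sum_range_succ, ← ncard_kFreeFarey, Nat.cast_add, add_sub_cancel_left]
  split_ifs
  · have h : ((Q + 1).totient : ℝ) ≤ (Q + 1 : ℕ) := by exact_mod_cast Nat.totient_le (Q + 1)
    push_cast at h
    rw [Real.norm_of_nonneg (by positivity), Real.norm_of_nonneg (by positivity)]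
    linarith
  · simp

theorem corollary1 (k m : ℕ) (b : ℤ) (hk : 2 ≤ k) (hm : 1 ≤ m) (hb : Int.gcd b (m : ℤ) = 1) :
    SetsUniformlyDistributedModOne (kFreeFarey k m b) ∧
      ∀ x : ℕ → ℝ, ListsSuccessively x (kFreeFarey k m b) → UniformlyDistributedModOne x := by
  have h := setsUniformlyDistributedModOne_kFreeFarey k m b hk hm hb
  exact ⟨h, fun x hx => h.of_listsSuccessively hx
    (tendsto_natCast_atTop_iff.mp (tendsto_ncard_kFreeFarey k m b hk hm hb))
    (isLittleO_ncard_kFreeFarey_succ_sub k m b hk hm hb)⟩
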